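/- Let $\Omega=\{0,1\}^{\mathbb N}$ be the Cantor space, and for a finite binary string $x$ let $[x]\subseteq\Omega$ be the set of its infinite extensions. Let $\mu$ be a computable finite Borel measure on $\Omega$, that is, some Turing machine, given a string $x$ and a rational $\delta>0$, returns a rational $\delta$-approximation of $\mu([x])$. A function $t:\Omega\to[0,\infty]$ is called lower semicomputable if some machine, given a rational $r$, enumerates a set of intervals $[x]$ whose union is $\{\omega: t(\omega)>r\}$. It is called probability bounded if $\mu\{\omega: t(\omega)>c\}\le 1/c$ for all rational $c>0$, and expectation bounded if $\int_\Omega t\,d\mu\le 1$. A function $t$ in a class of functions $\Omega\to[0,\infty]$ is called maximal in it if for every $s$ in the class there is a finite constant $C$ with $s(\omega)\le C\,t(\omega)$ for all $\omega\in\Omega$. There exist a maximal lower semicomputable expectation bounded function and a maximal lower semicomputable probability bounded function. Moreover, let $\mathbf t^E_\mu$ and $\mathbf t^P_\mu$ be any such maximal functions (expectation bounded and probability bounded, respectively), and put $\mathbf d^E_\mu=\log_2\mathbf t^E_\mu$ and $\mathbf d^P_\mu=\log_2\mathbf t^P_\mu$, with values in $[-\infty,\infty]$. Then: 1. there is a real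 constant $c$ such that for all $\omega\in\Omega$ $$\mathbf d^E_\mu(\omega)\le \mathbf d^P_\mu(\omega)+c;$$ 2. for every real $\varepsilon>0$ there is a real constant $c$ such that for all $\omega\in\Omega$ $$\mathbf d^P_\mu(\omega)\le \mathbf d^E_\mu(\omega)+(1+\varepsilon)\log_2\max\{\mathbf d^E_\mu(\omega),1\}+c .$$ -/

import Mathlib

open MeasureTheory
open scoped ENNReal NNReal

/-- The Cantor space of infinite binary sequences (product topology, Borel σ-algebra). -/
abbrev Cantor : Type := ℕ → Bool

/-- The interval `[x]`: the set of all infinite extensions of the binary string `x`. -/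
def interval (x : List Bool) : Set Cantor :=
  {ω | ∀ (i : ℕ) (h : i < x.length), ω i = x[i]}

/-- The nonnegative rational number coded by a pair of natural numbers. Every nonnegative
rational has a code, and codes are the inputs and outputs of machines. -/
def ratOfCode (p : ℕ × ℕ) : ℚ := (p.1 : ℚ) / ((p.2 : ℚ) + 1)

/-- A finite measure on the Cantor space is computable if some machine, given a string `x` and a
rational `ε > 0`, returns a (rational) `ε`-approximation of `μ [x]`. -/
def ComputableMeasure (μ : Measure Cantor) : Prop :=
  ∃ f : List Bool × (ℕ × ℕ) → ℕ × ℕ, Computable f ∧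
    ∀ (x : List Bool) (e : ℕ × ℕ), 0 < ratOfCode e →
      |μ.real (interval x) - (ratOfCode (f (x, e)) : ℝ)| ≤ (ratOfCode e : ℝ)

/-- A function `t : Cantor → [0, ∞]` is lower semicomputable if some machine, given a rational `r`,
enumerates a set of intervals whose union is `{ω | r < t ω}`. (For negative `r` this set is the
whole space, so only rationals `r ≥ 0` have to be considered.) -/
def LowerSemicomputable (t : Cantor → ℝ≥0∞) : Prop :=
  ∃ W : (ℕ × ℕ) × List Bool → Prop, REPred W ∧
    ∀ r : ℕ × ℕ,
      {ω | ENNReal.ofReal (ratOfCode r : ℝ) < t ω} = ⋃ x ∈ {x | W (r, x)}, interval x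

/-- `μ {t > c} ≤ 1 / c` for all rational `c > 0`. -/
def ProbabilityBounded (μ : Measure Cantor) (t : Cantor → ℝ≥0∞) : Prop :=
  ∀ c : ℚ, 0 < c → μ {ω | ENNReal.ofReal (c : ℝ) < t ω} ≤ ENNReal.ofReal (1 / (c : ℝ))

/-- `∫ t dμ ≤ 1`. -/
def ExpectationBounded (μ : Measure Cantor) (t : Cantor → ℝ≥0∞) : Prop :=
  ∫⁻ ω, t ω ∂μ ≤ 1

/-- `t` is a largest element, up to a multiplicative constant, of the class `P` of functions. -/
def IsLargestUpToConst (P : (Cantor → ℝ≥0∞) → Prop) (t : Cantor → ℝ≥0∞) : Prop :=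
  P t ∧ ∀ s, P s → ∃ C : ℝ≥0, ∀ ω, s ω ≤ (C : ℝ≥0∞) * t ω

/-- `t` is a maximal lower semicomputable expectation bounded function (a version of `t^E_μ`). -/
def IsMaximalExpectationBounded (μ : Measure Cantor) (t : Cantor → ℝ≥0∞) : Prop :=
  IsLargestUpToConst (fun s => LowerSemicomputable s ∧ ExpectationBounded μ s) t

/-- `t` is a maximal lower semicomputable probability bounded function (a version of `t^P_μ`). -/
def IsMaximalProbabilityBounded (μ : Measure Cantor) (t : Cantor → ℝ≥0∞) : Prop :=
  IsLargestUpToConst (fun s => LowerSemicomputable s ∧ ProbabilityBounded μ s) t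

/-- The binary logarithm `[0, ∞] → [-∞, ∞]`, with `log₂ 0 = -∞` and `log₂ ∞ = ∞`. -/
noncomputable def log2 (x : ℝ≥0∞) : EReal := ENNReal.log x / ((Real.log 2 : ℝ) : EReal)

/-- `log₂ (max x 1)` for an extended real number `x`. -/
noncomputable def truncLog2 (x : EReal) : EReal := log2 (max x 1).toENNReal

/-- The deficiency function `d = log₂ t` of a function `t : Cantor → [0, ∞]`. -/
noncomputable def deficiency (t : Cantor → ℝ≥0∞) (ω : Cantor) : EReal := log2 (t ω)

/-! Existence. A universal object is assembled from all programs. Program `p` yields natural-valued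
step functions that depend only on a prefix of `ω` and increase with its length. Integrals of step
functions can be approximated because `μ` is computable, so a computable test
(`exists_computable_integral_test`) can keep only those whose integral is below a fixed budget, up
to an additive slack of 2. The supremum of the kept functions still has bounded integral, whatever
`p` does; if `p` enumerates a member of the class, nothing is rejected. A weighted supremum over `p`
is then maximal. Rounding values to powers of 2 costs only a constant factor. In the probability
bounded case each level `2 ^ k` is tested separately and Markov's inequality is applied level by
level; the bounds for one program form a geometric series, so one weight per program suffices.

Comparison. By Markov's inequality expectation bounded functions are probability bounded, which
gives part 1. For part 2, damp `t = tP`: the supremum of `2 ^ j * j ^ (-(1 + η)) / N` over `j ≥ 1`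
with `2 ^ j < t` has integral at most `∑ j ^ (-(1 + η)) / N ≤ 1`
(`LowerSemicomputable.exists_expectationBounded`), so it lies below a multiple of `tE`. In
logarithms this reads `j - (1 + η) log j ≤ d + B` with `d = log₂ tE`, and `exists_logb_bound`
inverts it. -/

/-! ### Computability -/

section Computability

variable {α : Type*} [Primcodable α]

theorem Computable.sum_range {g : α → ℕ} {h : α → ℕ → ℕ} (hg : Computable g)
    (hh : Computable₂ h) : Computable fun a => ∑ i ∈ Finset.range (g a), h a i := by
  have key : Computable₂ fun (a : α) (p : ℕ × ℕ) => p.2 + h a p.1 :=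
    (Primrec.nat_add.to_comp.comp (Computable.snd.comp Computable.snd)
      (hh.comp Computable.fst (Computable.fst.comp Computable.snd))).to₂
  refine (Computable.nat_rec hg (Computable.const 0) key).of_eq fun a => ?_
  induction g a with
  | zero => simp
  | succ n ih => rw [Finset.sum_range_succ, ← ih]

theorem Computable.nat_pow {f g : α → ℕ} (hf : Computable f) (hg : Computable g) :
    Computable fun a => f a ^ g a := by
  have key : Computable₂ fun (a : α) (p : ℕ × ℕ) => p.2 * f a :=
    (Primrec.nat_mul.to_comp.comp (Computable.snd.comp Computable.snd)
      (hf.comp Computable.fst)).to₂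
  refine (Computable.nat_rec hg (Computable.const 1) key).of_eq fun a => ?_
  induction g a with
  | zero => simp
  | succ n ih => rw [pow_succ, ← ih]

theorem Computable.nat_add {f g : α → ℕ} (hf : Computable f) (hg : Computable g) :
    Computable fun a => f a + g a := Primrec.nat_add.to_comp.comp hf hg

theorem Computable.nat_mul {f g : α → ℕ} (hf : Computable f) (hg : Computable g) :
    Computable fun a => f a * g a := Primrec.nat_mul.to_comp.comp hf hg

theorem Computable.nat_div {f g : α → ℕ} (hf : Computable f) (hg : Computable g) :
    Computable fun a => f a / g a := Primrec.nat_div.to_comp.comp hf hg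

theorem Computable.decide_lt {f g : α → ℕ} (hf : Computable f) (hg : Computable g) :
    Computable fun a => decide (f a < g a) := Primrec.nat_lt.decide.to_comp.comp hf hg

theorem Computable.bool_and {f g : α → Bool} (hf : Computable f) (hg : Computable g) :
    Computable fun a => f a && g a := Primrec.and.to_comp.comp hf hg

theorem Computable.bool_or {f g : α → Bool} (hf : Computable f) (hg : Computable g) :
    Computable fun a => f a || g a := Primrec.or.to_comp.comp hf hg

theorem Computable.bool_toNat {f : α → Bool} (hf : Computable f) :
    Computable fun a => (f a).toNat :=
  (Computable.cond hf (Computable.const 1) (Computable.const 0)).of_eq fun a => by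
    cases f a <;> rfl

theorem REPred.of_exists {f : α → ℕ → Bool} (hf : Computable₂ f) :
    REPred fun a => ∃ n, f a n = true := by
  refine (Partrec.rfind (p := fun a n => Part.some (f a n)) hf).dom_re.of_eq fun a =>
    (Nat.rfind_dom (p := fun n => Part.some (f a n))).trans ?_
  constructor
  · rintro ⟨n, hn, -⟩
    exact ⟨n, (Part.mem_some_iff.1 hn).symm⟩
  · rintro ⟨n, hn⟩
    exact ⟨n, Part.mem_some_iff.2 hn.symm, fun _ => trivial⟩

theorem REPred.exists_code {p : α → Prop} (hp : REPred p) :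
    ∃ c : Nat.Partrec.Code, ∀ a, p a ↔
      ∃ n, (Nat.Partrec.Code.evaln n c (Encodable.encode a)).isSome = true := by
  obtain ⟨c, hc⟩ := Nat.Partrec.Code.exists_code.1 hp
  refine ⟨c, fun a => ?_⟩
  have h : (c.eval (Encodable.encode a)).Dom ↔ p a := by
    rw [hc]
    simp [Part.bind, Part.assert]
  rw [← h, Part.dom_iff_mem]
  simp only [Nat.Partrec.Code.evaln_complete, Option.isSome_iff_exists, Option.mem_def]
  exact exists_comm

theorem Computable.evaln {f : α → ℕ} {c : α → Nat.Partrec.Code} {g : α → ℕ}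
    (hf : Computable f) (hc : Computable c) (hg : Computable g) :
    Computable fun a => (Nat.Partrec.Code.evaln (f a) (c a) (g a)).isSome :=
  Primrec.option_isSome.to_comp.comp
    (Nat.Partrec.Code.primrec_evaln.to_comp.comp ((hf.pair hc).pair hg))

/-- Running the accepting program for `n` steps is decidable, which puts an r.e. predicate into
existential normal form; the closure properties below follow from it. -/
theorem REPred.exists_computable {p : α → Prop} (hp : REPred p) :
    ∃ f : α → ℕ → Bool, Computable₂ f ∧ ∀ a, p a ↔ ∃ n, f a n = true := by
  obtain ⟨c, hc⟩ := hp.exists_code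
  exact ⟨_, (Computable.evaln Computable.snd (Computable.const c)
    (Computable.encode.comp Computable.fst)).to₂, hc⟩

theorem REPred.exists_nat {p : α × ℕ → Prop} (hp : REPred p) :
    REPred fun a => ∃ k, p (a, k) := by
  obtain ⟨f, hf, h⟩ := hp.exists_computable
  have : Computable₂ fun (a : α) (n : ℕ) => f (a, n.unpair.1) n.unpair.2 :=
    (hf.comp (Computable.fst.pair
      (Computable.fst.comp (Computable.unpair.comp Computable.snd)))
      (Computable.snd.comp (Computable.unpair.comp Computable.snd))).to₂
  refine (REPred.of_exists this).of_eq fun a => ?_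
  simp only [h]
  constructor
  · rintro ⟨n, hn⟩
    exact ⟨_, _, hn⟩
  · rintro ⟨k, n, hn⟩
    exact ⟨Nat.pair k n, by simpa using hn⟩

theorem REPred.comp_computable {β : Type*} [Primcodable β] {p : β → Prop} (hp : REPred p)
    {f : α → β} (hf : Computable f) : REPred fun a => p (f a) := by
  obtain ⟨g, hg, h⟩ := hp.exists_computable
  exact (REPred.of_exists (hg.comp (hf.comp Computable.fst) Computable.snd).to₂).of_eq
    fun a => (h (f a)).symm

theorem REPred.and_computable {p : α → Prop} (hp : REPred p) {b : α → Bool}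
    (hb : Computable b) : REPred fun a => p a ∧ b a = true := by
  obtain ⟨g, hg, h⟩ := hp.exists_computable
  refine (REPred.of_exists (Computable.bool_and hg (hb.comp Computable.fst)).to₂).of_eq
    fun a => ?_
  simp [h]

theorem REPred.of_computable {b : α → Bool} (hb : Computable b) :
    REPred fun a => b a = true :=
  (REPred.of_exists (f := fun a _ => b a) (hb.comp Computable.fst).to₂).of_eq fun a => by simp

end Computability

/-! ### Prefixes and intervals -/

/-- The string of the first `n` bits of `ω`. -/
def bitPrefix (ω : ℕ → Bool) (n : ℕ) : List Bool := (List.range n).map ω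

/-- The strings `bitString n i`, `i < 2 ^ n`, are the strings of length `n`. -/
def bitString (n i : ℕ) : List Bool := bitPrefix i.testBit n

@[simp] theorem length_bitPrefix (ω : ℕ → Bool) (n : ℕ) : (bitPrefix ω n).length = n := by
  simp [bitPrefix]

theorem computable_bitString {α : Type*} [Primcodable α] {f g : α → ℕ} (hf : Computable f)
    (hg : Computable g) : Computable fun a => bitString (f a) (g a) := by
  -- `Primrec.list_map` asks for a primitive recursive bit function, so mere computability of powers
  -- is not enough here.
  have pow : Primrec fun n : ℕ => 2 ^ n := by
    refine (Primrec.nat_rec (α := Unit) (Primrec.const 1)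
      ((Primrec.nat_mul.comp (Primrec.const 2)
        (Primrec.snd.comp Primrec.snd)).to₂)).comp (Primrec.const ()) Primrec.id |>.of_eq ?_
    intro n
    induction n with
    | zero => rfl
    | succ n ih => rw [pow_succ', ← ih]; rfl
  have bit : Primrec₂ fun i j : ℕ => i.testBit j := by
    have : Primrec₂ fun i j : ℕ => decide (i / 2 ^ j % 2 = 1) :=
      Primrec.eq.decide.comp (Primrec.nat_mod.comp (Primrec.nat_div.comp Primrec.fst
        (pow.comp Primrec.snd)) (Primrec.const 2)) (Primrec.const 1)
    exact this.of_eq fun i j => (Nat.testBit_eq_decide_div_mod_eq).symm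
  have : Primrec₂ bitString :=
    Primrec.list_map (Primrec.list_range.comp Primrec.fst)
      (bit.comp (Primrec.snd.comp Primrec.fst) Primrec.snd).to₂
  exact this.to_comp.comp hf hg

theorem mem_interval_iff {ω : Cantor} {x : List Bool} :
    ω ∈ interval x ↔ bitPrefix ω x.length = x := by
  constructor
  · intro h
    refine List.ext_getElem (by simp) fun i h₁ h₂ => ?_
    simpa [bitPrefix] using h i h₂
  · intro h i hi
    have : (bitPrefix ω x.length)[i]'(by simpa using hi) = x[i] := by simp only [h]
    simpa [bitPrefix] using this

theorem mem_interval_bitPrefix (ω : Cantor) (n : ℕ) : ω ∈ interval (bitPrefix ω n) := by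
  simp [mem_interval_iff]

theorem take_bitPrefix {ω : Cantor} {m n : ℕ} (h : m ≤ n) :
    (bitPrefix ω n).take m = bitPrefix ω m := by
  simp [bitPrefix, ← List.map_take, List.take_range, h]

theorem bitPrefix_eq_iff {ω ω' : ℕ → Bool} {n : ℕ} :
    bitPrefix ω n = bitPrefix ω' n ↔ ∀ j < n, ω j = ω' j := by
  simp [bitPrefix]

theorem exists_bitString_eq (ω : Cantor) (n : ℕ) :
    ∃ i < 2 ^ n, bitString n i = bitPrefix ω n := by
  refine ⟨Nat.ofBits fun j : Fin n => ω j, Nat.ofBits_lt_two_pow _, ?_⟩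
  rw [bitString, bitPrefix_eq_iff]
  intro j hj
  rw [Nat.testBit_ofBits_lt _ _ hj]

theorem bitString_inj {n i j : ℕ} (hi : i < 2 ^ n) (hj : j < 2 ^ n)
    (h : bitString n i = bitString n j) : i = j := by
  rw [bitString, bitString, bitPrefix_eq_iff] at h
  refine Nat.eq_of_testBit_eq fun k => ?_
  rcases lt_or_ge k n with hk | hk
  · exact h k hk
  · have := Nat.pow_le_pow_right (n := 2) (by norm_num) hk
    rw [Nat.testBit_lt_two_pow (by omega), Nat.testBit_lt_two_pow (by omega)]

theorem measurableSet_interval (x : List Bool) : MeasurableSet (interval x) := by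
  have : interval x = ⋂ (i : ℕ) (h : i < x.length), {ω : Cantor | ω i = x[i]} := by
    ext ω
    simp [interval]
  rw [this]
  exact MeasurableSet.iInter fun i => MeasurableSet.iInter fun h =>
    measurableSet_eq_fun (measurable_pi_apply i) measurable_const

/-- The intervals of the `2 ^ n` strings of length `n` partition the space, so exactly one summand
survives. This gives measurability and integrals of step functions. -/
theorem sum_indicator_interval (F : List Bool → ℝ≥0∞) (ω : Cantor) (n : ℕ) :
    F (bitPrefix ω n) = ∑ i ∈ Finset.range (2 ^ n),
      (interval (bitString n i)).indicator (fun _ => F (bitString n i)) ω := by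
  obtain ⟨i, hi, h⟩ := exists_bitString_eq ω n
  rw [Finset.sum_eq_single i]
  · rw [Set.indicator_of_mem, h]
    rw [h]
    exact mem_interval_bitPrefix ω n
  · intro j hj hji
    refine Set.indicator_of_notMem (fun hmem => hji ?_) _
    rw [mem_interval_iff] at hmem
    refine bitString_inj (Finset.mem_range.1 hj) hi ?_
    rw [h, ← hmem]
    simp [bitString]
  · intro h'
    exact absurd (Finset.mem_range.2 hi) h'

theorem measurable_comp_bitPrefix (F : List Bool → ℝ≥0∞) (n : ℕ) :
    Measurable fun ω : Cantor => F (bitPrefix ω n) := by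
  simp_rw [sum_indicator_interval F _ n]
  exact Finset.measurable_sum _ fun i _ =>
    measurable_const.indicator (measurableSet_interval _)

theorem lintegral_comp_bitPrefix (μ : Measure Cantor) (F : List Bool → ℝ≥0∞) (n : ℕ) :
    ∫⁻ ω, F (bitPrefix ω n) ∂μ =
      ∑ i ∈ Finset.range (2 ^ n), F (bitString n i) * μ (interval (bitString n i)) := by
  simp_rw [sum_indicator_interval F _ n]
  rw [lintegral_finsetSum _ fun i _ => measurable_const.indicator (measurableSet_interval _)]
  refine Finset.sum_congr rfl fun i _ => ?_
  rw [lintegral_indicator_const (measurableSet_interval _)]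

/-! ### Testing integrals of step functions -/

/-- Approximate with precision `1 / (n + 1)`, scale by `n + 1` and round down: the scaled
approximation and the rounding each contribute an error of at most 1. -/
theorem ComputableMeasure.exists_nat_approx {μ : Measure Cantor} (hμ : ComputableMeasure μ) :
    ∃ A : List Bool → ℕ → ℕ, Computable₂ A ∧
      ∀ x n, |μ.real (interval x) * (n + 1) - A x n| ≤ 2 := by
  obtain ⟨f, hf, h⟩ := hμ
  have hf' : Computable fun p : List Bool × ℕ => f (p.1, (1, p.2)) :=
    hf.comp (Computable.fst.pair ((Computable.const 1).pair Computable.snd))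
  refine ⟨fun x n => (f (x, (1, n))).1 * (n + 1) / ((f (x, (1, n))).2 + 1),
    (Computable.nat_div (Computable.nat_mul (Computable.fst.comp hf')
      (Computable.succ.comp Computable.snd))
      (Computable.succ.comp (Computable.snd.comp hf'))).to₂, fun x n => ?_⟩
  have h₁ := h x (1, n) (by unfold ratOfCode; positivity)
  dsimp only
  generalize f (x, (1, n)) = q at h₁ ⊢
  obtain ⟨a, b⟩ := q
  simp only [ratOfCode] at h₁ ⊢
  push_cast at h₁
  have hn : (0 : ℝ) < n + 1 := by positivity
  have hb : (0 : ℝ) < b + 1 := by positivity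
  have h₂ : |μ.real (interval x) * (n + 1) - a * (n + 1) / (b + 1)| ≤ 1 := by
    have e : μ.real (interval x) * (n + 1) - a * (n + 1) / (b + 1) =
        (μ.real (interval x) - a / (b + 1)) * (n + 1) := by ring
    rw [e, abs_mul, abs_of_pos hn]
    calc _ ≤ 1 / ((n : ℝ) + 1) * (n + 1) := by gcongr
      _ = 1 := by field_simp
  have h₃ : ((a * (n + 1) / (b + 1) : ℕ) : ℝ) ≤ a * (n + 1) / (b + 1) := by
    have := @Nat.cast_div_le ℝ _ _ _ (a * (n + 1)) (b + 1)
    push_cast at this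
    exact this
  have h₄ : (a * (n + 1) / (b + 1) : ℝ) ≤ ((a * (n + 1) / (b + 1) : ℕ) : ℝ) + 1 := by
    rw [div_le_iff₀ hb]
    exact_mod_cast (Nat.lt_div_mul_add (a := a * (n + 1)) (b := b + 1) (by omega)).le.trans
      (by rw [add_mul, one_mul])
  rw [abs_le] at h₂ ⊢
  constructor <;> linarith [h₂.1, h₂.2]

/-- With `S` the sum of all values of the step function, measuring each interval at scale `2 * S +
1` makes the total error at most `2 * S`, hence less than 1 after dividing by the scale. Comparing
the approximation with `K + 1` therefore separates integrals `≤ K` from integrals `> K + 2`. -/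
theorem exists_computable_integral_test (μ : Measure Cantor) [IsFiniteMeasure μ]
    (hμ : ComputableMeasure μ) {F : ℕ → List Bool → ℕ} (hF : Computable₂ F) (K : ℕ) :
    ∃ ok : ℕ → ℕ → Bool, Computable₂ ok ∧ ∀ p n,
      (∫⁻ ω, (F p (bitPrefix ω n) : ℝ≥0∞) ∂μ ≤ K → ok p n = true) ∧
      (ok p n = true → ∫⁻ ω, (F p (bitPrefix ω n) : ℝ≥0∞) ∂μ ≤ K + 2) := by
  obtain ⟨A, hA, hAμ⟩ := hμ.exists_nat_approx
  let S : ℕ → ℕ → ℕ := fun p n => ∑ i ∈ Finset.range (2 ^ n), F p (bitString n i)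
  let T : ℕ → ℕ → ℕ := fun p n => ∑ i ∈ Finset.range (2 ^ n),
    F p (bitString n i) * A (bitString n i) (2 * S p n)
  have hpow : Computable fun q : ℕ × ℕ => 2 ^ q.2 :=
    Computable.nat_pow (Computable.const 2) Computable.snd
  have hstr : Computable fun q : (ℕ × ℕ) × ℕ => bitString q.1.2 q.2 :=
    computable_bitString (Computable.snd.comp Computable.fst) Computable.snd
  have hFs : Computable fun q : (ℕ × ℕ) × ℕ => F q.1.1 (bitString q.1.2 q.2) :=
    hF.comp (Computable.fst.comp Computable.fst) hstr
  have hS : Computable fun q : ℕ × ℕ => S q.1 q.2 := Computable.sum_range hpow hFs.to₂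
  have h2S : Computable fun q : ℕ × ℕ => 2 * S q.1 q.2 :=
    Computable.nat_mul (Computable.const 2) hS
  have hT : Computable fun q : ℕ × ℕ => T q.1 q.2 :=
    Computable.sum_range hpow
      (Computable.nat_mul hFs (hA.comp hstr (h2S.comp Computable.fst))).to₂
  refine ⟨fun p n => decide (T p n < (K + 1) * (2 * S p n + 1) + 1),
    (Computable.decide_lt hT (Computable.succ.comp (Computable.nat_mul (Computable.const (K + 1))
      (Computable.succ.comp h2S)))).to₂, fun p n => ?_⟩
  set I : ℝ := ∑ i ∈ Finset.range (2 ^ n),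
    (F p (bitString n i) : ℝ) * μ.real (interval (bitString n i)) with hI
  have hI0 : 0 ≤ I := Finset.sum_nonneg fun i _ => by positivity
  have hint : ∫⁻ ω, (F p (bitPrefix ω n) : ℝ≥0∞) ∂μ = ENNReal.ofReal I := by
    rw [lintegral_comp_bitPrefix μ (fun x => (F p x : ℝ≥0∞)) n, hI,
      ENNReal.ofReal_sum_of_nonneg fun i _ => by positivity]
    refine Finset.sum_congr rfl fun i _ => ?_
    rw [ENNReal.ofReal_mul (by positivity), ENNReal.ofReal_natCast, ofReal_measureReal]
  have herr : |I * (2 * S p n + 1) - T p n| ≤ 2 * S p n := by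
    have e : I * (2 * S p n + 1) - T p n = ∑ i ∈ Finset.range (2 ^ n), F p (bitString n i) *
        (μ.real (interval (bitString n i)) * (((2 * S p n : ℕ) : ℝ) + 1) -
          A (bitString n i) (2 * S p n)) := by
      simp only [T, hI, Finset.sum_mul, Nat.cast_sum, ← Finset.sum_sub_distrib]
      refine Finset.sum_congr rfl fun i _ => ?_
      push_cast
      ring
    rw [e]
    calc _ ≤ ∑ i ∈ Finset.range (2 ^ n), |F p (bitString n i) *
        (μ.real (interval (bitString n i)) * (((2 * S p n : ℕ) : ℝ) + 1) -
          A (bitString n i) (2 * S p n))| := Finset.abs_sum_le_sum_abs _ _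
      _ ≤ ∑ i ∈ Finset.range (2 ^ n), (F p (bitString n i) : ℝ) * 2 := by
        refine Finset.sum_le_sum fun i _ => ?_
        rw [abs_mul, Nat.abs_cast]
        gcongr
        exact hAμ _ _
      _ = 2 * S p n := by
        simp only [S]
        push_cast
        rw [← Finset.sum_mul, mul_comm]
  have hS0 : (0 : ℝ) ≤ S p n := by positivity
  rw [abs_le] at herr
  rw [hint]
  constructor
  · intro h
    rw [ENNReal.ofReal_le_natCast] at h
    rw [decide_eq_true_iff, Nat.lt_succ_iff]
    have : (T p n : ℝ) ≤ (K + 1) * (2 * S p n + 1) := by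
      nlinarith [herr.1]
    exact_mod_cast this
  · intro h
    rw [decide_eq_true_iff, Nat.lt_succ_iff] at h
    have h' : (T p n : ℝ) ≤ (K + 1) * (2 * S p n + 1) := by exact_mod_cast h
    have : I ≤ ((K + 2 : ℕ) : ℝ) := by
      push_cast
      have : I * (2 * S p n + 1) ≤ (K + 2) * (2 * S p n + 1) := by linarith [herr.2]
      exact le_of_mul_le_mul_right this (by positivity)
    have h₂ := ENNReal.ofReal_le_natCast.2 this
    exact_mod_cast h₂

/-! ### Suprema of accepted step functions -/

/-- The supremum of the step functions `ω ↦ F p (ω ↾ n)` over all `n` accepted by `ok p`. -/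
noncomputable def acceptedSup (F : ℕ → List Bool → ℕ) (ok : ℕ → ℕ → Bool) (p : ℕ) (ω : Cantor) :
    ℝ≥0∞ :=
  ⨆ n : {n // ok p n = true}, (F p (bitPrefix ω n) : ℝ≥0∞)

/-- The supremum of the functions `acceptedSup F ok p` with weights `1 / D p`. -/
noncomputable def weightedSup (F : ℕ → List Bool → ℕ) (ok : ℕ → ℕ → Bool) (D : ℕ → ℕ)
    (ω : Cantor) : ℝ≥0∞ :=
  ⨆ p, acceptedSup F ok p ω / (D p : ℝ≥0∞)

theorem measurable_acceptedSup (F : ℕ → List Bool → ℕ) (ok : ℕ → ℕ → Bool) (p : ℕ) :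
    Measurable (acceptedSup F ok p) :=
  Measurable.iSup fun n => measurable_comp_bitPrefix (fun x => (F p x : ℝ≥0∞)) n

/-- Monotone convergence. The accepted lengths may be any subset of `ℕ`, but along them the step
functions still form a directed family. -/
theorem lintegral_acceptedSup_le {μ : Measure Cantor} {F : ℕ → List Bool → ℕ}
    {ok : ℕ → ℕ → Bool} {p : ℕ} (hF : ∀ ω, Monotone fun n => F p (bitPrefix ω n)) {B : ℝ≥0∞}
    (hB : ∀ n, ok p n = true → ∫⁻ ω, (F p (bitPrefix ω n) : ℝ≥0∞) ∂μ ≤ B) :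
    ∫⁻ ω, acceptedSup F ok p ω ∂μ ≤ B := by
  unfold acceptedSup
  rw [lintegral_iSup_directed]
  · exact iSup_le fun n => hB n n.2
  · exact fun n => (measurable_comp_bitPrefix (fun x => (F p x : ℝ≥0∞)) n).aemeasurable
  · refine directed_of_isDirected_le ?_
    intro m n hmn ω
    have := hF ω (show (m : ℕ) ≤ n from hmn)
    exact Nat.cast_le.2 this

theorem ofReal_ratOfCode_lt_div_iff (r : ℕ × ℕ) (a : ℕ) {D : ℕ} (hD : 0 < D) :
    ENNReal.ofReal (ratOfCode r : ℝ) < (a : ℝ≥0∞) / (D : ℝ≥0∞) ↔ D * r.1 < a * (r.2 + 1) := by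
  have hD' : (0 : ℝ) < D := by exact_mod_cast hD
  have hr : (0 : ℝ) < r.2 + 1 := by positivity
  rw [← ENNReal.ofReal_natCast a, ← ENNReal.ofReal_natCast D, ← ENNReal.ofReal_div_of_pos hD']
  have h0 : (0 : ℝ) ≤ (ratOfCode r : ℝ) := by
    unfold ratOfCode
    positivity
  rw [ENNReal.ofReal_lt_ofReal_iff_of_nonneg h0]
  unfold ratOfCode
  push_cast
  rw [div_lt_div_iff₀ hr hD', mul_comm]
  exact_mod_cast Iff.rfl

/-- A supremum strictly exceeds a rational iff one of its terms does, and for a single term this is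
a decidable inequality of natural numbers that depends only on a prefix of `ω`. -/
theorem lowerSemicomputable_weightedSup {F : ℕ → List Bool → ℕ} {ok : ℕ → ℕ → Bool} {D : ℕ → ℕ}
    (hF : Computable₂ F) (hok : Computable₂ ok) (hD : Computable D) (hD0 : ∀ p, 0 < D p) :
    LowerSemicomputable (weightedSup F ok D) := by
  have hx : Computable fun q : ((ℕ × ℕ) × List Bool) × ℕ => q.1.2 :=
    Computable.snd.comp Computable.fst
  have hr : Computable fun q : ((ℕ × ℕ) × List Bool) × ℕ => q.1.1 :=
    Computable.fst.comp Computable.fst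
  have hc : Computable₂ fun (q : (ℕ × ℕ) × List Bool) (p : ℕ) =>
      ok p q.2.length && decide (D p * q.1.1 < F p q.2 * (q.1.2 + 1)) :=
    (Computable.bool_and (hok.comp Computable.snd (Computable.list_length.comp hx))
      (Computable.decide_lt
        (Computable.nat_mul (hD.comp Computable.snd) (Computable.fst.comp hr))
        (Computable.nat_mul (hF.comp Computable.snd hx)
          (Computable.succ.comp (Computable.snd.comp hr))))).to₂
  refine ⟨_, REPred.of_exists hc, fun r => ?_⟩
  ext ω
  simp only [weightedSup, acceptedSup, ENNReal.iSup_div, Set.mem_ofPred_eq, lt_iSup_iff,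
    Set.mem_iUnion, exists_prop, Bool.and_eq_true, decide_eq_true_iff,
    ofReal_ratOfCode_lt_div_iff r _ (hD0 _)]
  constructor
  · rintro ⟨p, n, h⟩
    exact ⟨bitPrefix ω n, ⟨p, by simpa using n.2, h⟩, mem_interval_bitPrefix ω n⟩
  · rintro ⟨x, ⟨p, h₁, h₂⟩, hω⟩
    rw [mem_interval_iff] at hω
    exact ⟨p, ⟨_, h₁⟩, by simpa only [hω] using h₂⟩

theorem LowerSemicomputable.measurable {t : Cantor → ℝ≥0∞} (ht : LowerSemicomputable t) :
    Measurable t := by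
  obtain ⟨W, -, hW⟩ := ht
  have hset : ∀ q : ℚ, 0 ≤ q → MeasurableSet {ω | ENNReal.ofReal (q : ℝ) < t ω} := by
    intro q hq
    have : ratOfCode (q.num.toNat, q.den - 1) = q := by
      have h1 : ((q.den - 1 : ℕ) : ℚ) + 1 = q.den := by
        rw [Nat.cast_sub q.pos]
        simp
      have h2 : ((q.num.toNat : ℕ) : ℚ) = q.num := by
        exact_mod_cast Int.toNat_of_nonneg (Rat.num_nonneg.2 hq)
      simp only [ratOfCode, h1, h2, Rat.num_div_den]
    rw [← this, hW]
    exact MeasurableSet.biUnion (Set.to_countable _) fun x _ => measurableSet_interval x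
  refine measurable_of_Ioi fun a => ?_
  have : t ⁻¹' Set.Ioi a = ⋃ (q : ℚ) (_ : 0 ≤ q ∧ a ≤ ENNReal.ofReal (q : ℝ)),
      {ω | ENNReal.ofReal (q : ℝ) < t ω} := by
    ext ω
    simp only [Set.mem_preimage, Set.mem_Ioi, Set.mem_iUnion, Set.mem_ofPred_eq, exists_prop]
    constructor
    · intro h
      obtain ⟨q, hq, h₁, h₂⟩ := ENNReal.lt_iff_exists_rat_btwn.1 h
      exact ⟨q, ⟨hq, h₁.le⟩, h₂⟩
    · rintro ⟨q, ⟨-, h₁⟩, h₂⟩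
      exact h₁.trans_lt h₂
  rw [this]
  exact MeasurableSet.iUnion fun q => MeasurableSet.iUnion fun hq => hset q hq.1

/-! ### Enumerating all lower semicomputable functions -/

/-- Within `s` steps, the program with number `p` accepts the string `y` for the threshold
`2 ^ k`. -/
def enumeratedBy (p k s : ℕ) (y : List Bool) : Bool :=
  (Nat.Partrec.Code.evaln s (Denumerable.ofNat Nat.Partrec.Code p)
    (Encodable.encode (((2 ^ k, 0), y) : (ℕ × ℕ) × List Bool))).isSome

/-- Within `x.length` steps, the program with number `p` accepts a prefix of `x` for the threshold
`2 ^ k`. -/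
def caught (p k : ℕ) (x : List Bool) : Bool :=
  decide (0 < ∑ i ∈ Finset.range (x.length + 1), (enumeratedBy p k x.length (x.take i)).toNat)

theorem computable_caught {α : Type*} [Primcodable α] {p k : α → ℕ} {x : α → List Bool}
    (hp : Computable p) (hk : Computable k) (hx : Computable x) :
    Computable fun a => caught (p a) (k a) (x a) := by
  have htake : Computable₂ fun (a : α) (i : ℕ) => (x a).take i :=
    Primrec.list_take.to_comp.comp Computable.snd (hx.comp Computable.fst)
  have : Computable₂ fun (a : α) (i : ℕ) =>
      (enumeratedBy (p a) (k a) (x a).length ((x a).take i)).toNat :=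
    Computable.bool_toNat (Computable.evaln
      (Computable.list_length.comp (hx.comp Computable.fst))
      ((Computable.ofNat Nat.Partrec.Code).comp (hp.comp Computable.fst))
      (Computable.encode.comp (((Computable.nat_pow (Computable.const 2)
        (hk.comp Computable.fst)).pair (Computable.const 0)).pair htake)))
  exact Computable.decide_lt (Computable.const 0)
    (Computable.sum_range (Computable.succ.comp (Computable.list_length.comp hx)) this)

theorem caught_bitPrefix_iff {p k n : ℕ} {ω : Cantor} :
    caught p k (bitPrefix ω n) = true ↔
      ∃ i ≤ n, enumeratedBy p k n (bitPrefix ω i) = true := by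
  rw [caught, decide_eq_true_iff, Finset.sum_pos_iff]
  simp only [length_bitPrefix, Finset.mem_range, Nat.lt_succ_iff]
  refine exists_congr fun i => and_congr_right fun hi => ?_
  rw [take_bitPrefix hi]
  cases enumeratedBy p k n (bitPrefix ω i) <;> simp

theorem enumeratedBy_mono {p k m n : ℕ} {y : List Bool} (hmn : m ≤ n)
    (h : enumeratedBy p k m y = true) : enumeratedBy p k n y = true := by
  rw [enumeratedBy, Option.isSome_iff_exists] at h ⊢
  obtain ⟨v, hv⟩ := h
  exact ⟨v, Nat.Partrec.Code.evaln_mono hmn hv⟩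

theorem caught_mono {p k m n : ℕ} {ω : Cantor} (hmn : m ≤ n)
    (h : caught p k (bitPrefix ω m) = true) : caught p k (bitPrefix ω n) = true := by
  rw [caught_bitPrefix_iff] at h ⊢
  obtain ⟨i, hi, h⟩ := h
  exact ⟨i, hi.trans hmn, enumeratedBy_mono hmn h⟩

theorem ofReal_ratOfCode_two_pow (k : ℕ) :
    ENNReal.ofReal (ratOfCode (2 ^ k, 0) : ℝ) = 2 ^ k := by
  have : (ratOfCode (2 ^ k, 0) : ℝ) = ((2 ^ k : ℕ) : ℝ) := by simp [ratOfCode]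
  rw [this, ENNReal.ofReal_natCast]
  simp

theorem LowerSemicomputable.exists_caught {t : Cantor → ℝ≥0∞} (ht : LowerSemicomputable t) :
    ∃ p, ∀ k ω, 2 ^ k < t ω ↔ ∃ n, caught p k (bitPrefix ω n) = true := by
  obtain ⟨W, hW, h⟩ := ht
  obtain ⟨c, hc⟩ := hW.exists_code
  refine ⟨Encodable.encode c, fun k ω => ?_⟩
  have h₁ : 2 ^ k < t ω ↔ ∃ x, W ((2 ^ k, 0), x) ∧ ω ∈ interval x := by
    have := Set.ext_iff.1 (h (2 ^ k, 0)) ω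
    simpa only [ofReal_ratOfCode_two_pow, Set.mem_ofPred_eq, Set.mem_iUnion, exists_prop] using this
  simp only [h₁, caught_bitPrefix_iff, hc, enumeratedBy, Denumerable.ofNat_encode]
  constructor
  · rintro ⟨x, ⟨m, hm⟩, hω⟩
    rw [mem_interval_iff] at hω
    -- One number bounds both the running time and the prefix length, so it must dominate both.
    refine ⟨max m x.length, x.length, le_max_right _ _, ?_⟩
    rw [hω]
    rw [Option.isSome_iff_exists] at hm ⊢
    obtain ⟨v, hv⟩ := hm
    exact ⟨v, Nat.Partrec.Code.evaln_mono (le_max_left _ _) hv⟩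
  · rintro ⟨n, i, -, hi⟩
    exact ⟨_, ⟨n, hi⟩, mem_interval_bitPrefix ω i⟩

/-! ### Existence of maximal functions -/

/-- If `2 * T < v`, then `2 ^ k ≤ T` implies `2 ^ (k + 1) < v`, hence `2 ^ (k + 1) ≤ T`; so `T = ⊤`,
which is absurd. The bound `1 ≤ T` starts the induction, and is the reason why the step functions
below include the constant 1. -/
theorem le_two_mul_of_two_pow_le {v T : ℝ≥0∞} (h₁ : 1 ≤ T) (h : ∀ k : ℕ, 2 ^ k < v → 2 ^ k ≤ T) :
    v ≤ 2 * T := by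
  by_contra! hv
  have key : ∀ k : ℕ, (2 : ℝ≥0∞) ^ k ≤ T := by
    intro k
    induction k with
    | zero => simpa using h₁
    | succ k ih =>
      refine h _ (lt_of_le_of_lt ?_ hv)
      rw [pow_succ']
      gcongr
  have hT : T = ⊤ := by
    by_contra hT
    obtain ⟨n, hn⟩ := ENNReal.exists_nat_gt hT
    refine absurd (key n) (not_le.2 (hn.trans ?_))
    exact_mod_cast n.lt_two_pow_self
  simp [hT] at hv

/-- The geometric sum is at most twice its largest selected term, which is below `v`. -/
theorem sum_two_pow_mul_toNat_le {v : ℝ≥0∞} {b : ℕ → Bool} (hb : ∀ k, b k = true → 2 ^ k < v)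
    (n : ℕ) : ((∑ k ∈ Finset.range n, 2 ^ k * (b k).toNat : ℕ) : ℝ≥0∞) ≤ 2 * v := by
  induction n with
  | zero => simp
  | succ n ih =>
    cases hn : b n with
    | false => simpa [Finset.sum_range_succ, hn] using ih
    | true =>
      have h : ∑ k ∈ Finset.range (n + 1), 2 ^ k * (b k).toNat ≤ 2 * 2 ^ n := by
        calc _ ≤ ∑ k ∈ Finset.range (n + 1), 2 ^ k :=
              Finset.sum_le_sum fun k _ => by cases b k <;> simp
          _ ≤ 2 ^ (n + 1) := by
            rw [Nat.geomSum_eq le_rfl]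
            exact (Nat.div_le_self _ _).trans (Nat.sub_le _ _)
          _ = 2 * 2 ^ n := pow_succ' _ _
      calc ((∑ k ∈ Finset.range (n + 1), 2 ^ k * (b k).toNat : ℕ) : ℝ≥0∞)
          ≤ ((2 * 2 ^ n : ℕ) : ℝ≥0∞) := Nat.cast_le.2 h
        _ = 2 * 2 ^ n := by push_cast; rfl
        _ ≤ 2 * v := by gcongr; exact (hb n hn).le

theorem exists_nat_measure_univ_le (μ : Measure Cantor) [IsFiniteMeasure μ] :
    ∃ K : ℕ, μ Set.univ ≤ K :=
  (ENNReal.exists_nat_gt (measure_ne_top μ Set.univ)).imp fun _ h => h.le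

/-- The step functions for the program `p`: up to a constant factor, their supremum is
`max 1 t` if the program accepts the sets `{t > 2 ^ k}`. -/
def expectationStep (p : ℕ) (x : List Bool) : ℕ :=
  1 + ∑ k ∈ Finset.range x.length, 2 ^ k * (caught p k x).toNat

theorem computable_expectationStep : Computable₂ expectationStep :=
  Computable.nat_add (Computable.const 1) (Computable.sum_range
    (Computable.list_length.comp Computable.snd)
    (Computable.nat_mul (Computable.nat_pow (Computable.const 2) Computable.snd)
      (Computable.bool_toNat (computable_caught (Computable.fst.comp Computable.fst)
        Computable.snd (Computable.snd.comp Computable.fst)))).to₂)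

theorem toNat_caught_mono (p k : ℕ) {m n : ℕ} {ω : Cantor} (hmn : m ≤ n) :
    (caught p k (bitPrefix ω m)).toNat ≤ (caught p k (bitPrefix ω n)).toNat :=
  Bool.toNat_le_toNat (caught_mono hmn)

theorem expectationStep_mono (p : ℕ) (ω : Cantor) :
    Monotone fun n => expectationStep p (bitPrefix ω n) := by
  intro m n hmn
  simp only [expectationStep, length_bitPrefix]
  gcongr 1 + ?_
  calc _ ≤ ∑ k ∈ Finset.range m, 2 ^ k * (caught p k (bitPrefix ω n)).toNat :=
        Finset.sum_le_sum fun k _ => Nat.mul_le_mul_left _ (toNat_caught_mono p k hmn)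
    _ ≤ _ := Finset.sum_le_sum_of_subset (Finset.range_mono hmn)

theorem two_pow_le_expectationStep {p k : ℕ} {x : List Bool} (h : caught p k x = true)
    (hk : k < x.length) : 2 ^ k ≤ expectationStep p x := by
  unfold expectationStep
  refine le_add_left ?_
  have := Finset.single_le_sum (f := fun k => 2 ^ k * (caught p k x).toNat)
    (fun _ _ => Nat.zero_le _) (Finset.mem_range.2 hk)
  simpa [h] using this

theorem exists_isMaximalExpectationBounded (μ : Measure Cantor) [IsFiniteMeasure μ]
    (hμ : ComputableMeasure μ) : ∃ t, IsMaximalExpectationBounded μ t := by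
  obtain ⟨K, hK⟩ := exists_nat_measure_univ_le μ
  obtain ⟨ok, hok, hokμ⟩ :=
    exists_computable_integral_test μ hμ computable_expectationStep (K + 2)
  -- The test with budget `K + 2` lets through integrals up to `K + 4`; the remaining weights `2 ^
  -- (-(p + 1))` sum to 1.
  let D : ℕ → ℕ := fun p => (K + 4) * 2 ^ (p + 1)
  have hD0 : ∀ p, 0 < D p := fun p => by positivity
  have hD : Computable D := Computable.nat_mul (Computable.const _)
    (Computable.nat_pow (Computable.const 2) Computable.succ)
  refine ⟨weightedSup expectationStep ok D,
    ⟨lowerSemicomputable_weightedSup computable_expectationStep hok hD hD0, ?_⟩, ?_⟩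
  · have hle : ∀ p, ∫⁻ ω, acceptedSup expectationStep ok p ω ∂μ ≤ ((K + 4 : ℕ) : ℝ≥0∞) := by
      intro p
      refine lintegral_acceptedSup_le (expectationStep_mono p) fun n hn => ?_
      refine ((hokμ p n).2 hn).trans_eq ?_
      push_cast
      ring
    calc ∫⁻ ω, weightedSup expectationStep ok D ω ∂μ
        ≤ ∫⁻ ω, ∑' p, acceptedSup expectationStep ok p ω / (D p : ℝ≥0∞) ∂μ :=
          lintegral_mono fun ω => iSup_le fun p => ENNReal.le_tsum p
      _ = ∑' p, (∫⁻ ω, acceptedSup expectationStep ok p ω ∂μ) / (D p : ℝ≥0∞) := by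
          simp_rw [div_eq_mul_inv]
          rw [lintegral_tsum fun p => ((measurable_acceptedSup _ _ p).mul_const _).aemeasurable]
          simp_rw [lintegral_mul_const _ (measurable_acceptedSup _ _ _)]
      _ ≤ ∑' p, (2⁻¹ : ℝ≥0∞) ^ (p + 1) := by
          refine ENNReal.tsum_le_tsum fun p => ENNReal.div_le_of_le_mul ((hle p).trans_eq ?_)
          simp only [D]
          rw [Nat.cast_mul, mul_left_comm, Nat.cast_pow, Nat.cast_ofNat, ← ENNReal.inv_pow,
            ENNReal.inv_mul_cancel (by simp) (by simp), mul_one]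
      _ = 1 := by
          rw [ENNReal.tsum_geometric_add_one, ENNReal.one_sub_inv_two, inv_inv,
            ENNReal.inv_mul_cancel (by simp) (by simp)]
  · rintro s ⟨hs, hsμ⟩
    obtain ⟨p, hp⟩ := hs.exists_caught
    -- Every step function of `p` is at most `1 + 2 * s`, whose integral is within the budget `K +
    -- 2`.
    have hall : ∀ n, ok p n = true := by
      intro n
      refine (hokμ p n).1 ?_
      calc _ ≤ ∫⁻ ω, 1 + 2 * s ω ∂μ := by
            refine lintegral_mono fun ω => ?_
            rw [expectationStep, Nat.cast_add, Nat.cast_one]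
            gcongr
            exact sum_two_pow_mul_toNat_le (fun k hk => (hp k ω).2 ⟨n, hk⟩) _
        _ = μ Set.univ + 2 * ∫⁻ ω, s ω ∂μ := by
            rw [lintegral_add_left measurable_const, lintegral_const_mul _ hs.measurable]
            simp
        _ ≤ K + 2 * 1 := by gcongr; exact hsμ
        _ = _ := by push_cast; ring
    refine ⟨2 * (D p : ℝ≥0), fun ω => ?_⟩
    have hle : ∀ n, (expectationStep p (bitPrefix ω n) : ℝ≥0∞) ≤
        acceptedSup expectationStep ok p ω := fun n =>
      le_iSup (fun n : {n // ok p n = true} => (expectationStep p (bitPrefix ω n) : ℝ≥0∞))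
        ⟨n, hall n⟩
    have hacc : s ω ≤ 2 * acceptedSup expectationStep ok p ω := by
      refine le_two_mul_of_two_pow_le ((hle 0).trans' ?_) fun k hk => ?_
      · simp [expectationStep]
      · obtain ⟨n, hn⟩ := (hp k ω).1 hk
        -- The prefix must be long enough both for level `k` to be caught and for the sum in
        -- `expectationStep` to contain the term `k`.
        refine (hle (max n (k + 1))).trans' ?_
        exact_mod_cast two_pow_le_expectationStep (caught_mono (le_max_left n (k + 1)) hn)
          (by simp)
    calc s ω ≤ 2 * acceptedSup expectationStep ok p ω := hacc
      _ = 2 * (D p * (acceptedSup expectationStep ok p ω / D p)) := by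
          rw [ENNReal.mul_div_cancel (by exact_mod_cast (hD0 p).ne') (by simp)]
      _ ≤ 2 * (D p * weightedSup expectationStep ok D ω) := by
          gcongr
          exact le_iSup (fun p => acceptedSup expectationStep ok p ω / (D p : ℝ≥0∞)) p
      _ = _ := by push_cast; ring

/-- The step functions for the program and the level coded by `q`: their supremum is `2 ^ k` on
the set `{t > 2 ^ k}` if the program accepts the sets `{t > 2 ^ k}`. -/
def probabilityStep (q : ℕ) (x : List Bool) : ℕ :=
  2 ^ q.unpair.2 * (decide (q.unpair.2 < 1) || caught q.unpair.1 q.unpair.2 x).toNat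

theorem computable_probabilityStep : Computable₂ probabilityStep := by
  have h₁ : Computable fun a : ℕ × List Bool => a.1.unpair.1 :=
    Computable.fst.comp (Computable.unpair.comp Computable.fst)
  have h₂ : Computable fun a : ℕ × List Bool => a.1.unpair.2 :=
    Computable.snd.comp (Computable.unpair.comp Computable.fst)
  exact Computable.nat_mul (Computable.nat_pow (Computable.const 2) h₂) (Computable.bool_toNat
    (Computable.bool_or (Computable.decide_lt h₂ (Computable.const 1))
      (computable_caught h₁ h₂ Computable.snd)))

theorem probabilityStep_mono (q : ℕ) (ω : Cantor) :
    Monotone fun n => probabilityStep q (bitPrefix ω n) := by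
  intro m n hmn
  refine Nat.mul_le_mul_left _ (Bool.toNat_le_toNat fun h => ?_)
  rw [Bool.or_eq_true] at h ⊢
  exact h.imp_right (caught_mono hmn)

/-- Having only these two values, the function exceeds a threshold either nowhere or exactly where
it equals `2 ^ k`; Markov's inequality is then used at `2 ^ k` instead of at the threshold, and the
bounds become summable over `k`. -/
theorem acceptedSup_probabilityStep_eq_zero_or (ok : ℕ → ℕ → Bool) (q : ℕ) (ω : Cantor) :
    acceptedSup probabilityStep ok q ω = 0 ∨
      acceptedSup probabilityStep ok q ω = 2 ^ q.unpair.2 := by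
  by_cases h : ∃ n : {n // ok q n = true}, (decide (q.unpair.2 < 1) ||
      caught q.unpair.1 q.unpair.2 (bitPrefix ω n)) = true
  · obtain ⟨n, hn⟩ := h
    right
    refine le_antisymm (iSup_le fun m => ?_) (le_iSup_of_le n ?_)
    · have : probabilityStep q (bitPrefix ω m) ≤ 2 ^ q.unpair.2 := by
        refine (Nat.mul_le_mul_left _ (Bool.toNat_le _)).trans ?_
        rw [mul_one]
      exact_mod_cast this
    · rw [probabilityStep, hn]
      simp
  · push Not at h
    left
    refine le_antisymm (iSup_le fun m => ?_) bot_le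
    rw [probabilityStep, Bool.eq_false_of_not_eq_true (h m)]
    simp

/-- The sum starts at the least `k₀` with `A < 2 ^ k₀`, and from there it is dominated by `A⁻¹`
times the geometric series of ratio 1/2. -/
theorem tsum_ite_lt_two_pow_le (A : ℝ≥0∞) :
    ∑' k : ℕ, (if A < 2 ^ k then ((2 : ℝ≥0∞) ^ k)⁻¹ else 0) ≤ 2 * A⁻¹ := by
  by_cases h : ∃ k : ℕ, A < 2 ^ k
  · obtain ⟨k₀, hk₀, hmin⟩ : ∃ k₀ : ℕ, A < 2 ^ k₀ ∧ ∀ k < k₀, ¬ A < 2 ^ k := by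
      classical exact ⟨Nat.find h, Nat.find_spec h, fun k hk => Nat.find_min h hk⟩
    have h₀ : ∑ k ∈ Finset.range k₀, (if A < 2 ^ k then ((2 : ℝ≥0∞) ^ k)⁻¹ else 0) = 0 :=
      Finset.sum_eq_zero fun k hk => if_neg (hmin k (Finset.mem_range.1 hk))
    rw [← Summable.sum_add_tsum_nat_add' (k := k₀) ENNReal.summable, h₀, zero_add]
    calc _ ≤ ∑' k : ℕ, A⁻¹ * (2⁻¹ : ℝ≥0∞) ^ k := by
          refine ENNReal.tsum_le_tsum fun k => ?_
          split_ifs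
          · rw [pow_add, ENNReal.mul_inv (by simp) (by simp), mul_comm, ← ENNReal.inv_pow]
            gcongr
          · exact zero_le
      _ = 2 * A⁻¹ := by
          rw [ENNReal.tsum_mul_left, ENNReal.tsum_geometric, ENNReal.one_sub_inv_two, inv_inv,
            mul_comm]
  · push Not at h
    simp [fun k => not_lt.2 (h k)]

theorem ProbabilityBounded.measure_two_pow_lt_le {μ : Measure Cantor} {s : Cantor → ℝ≥0∞}
    (hs : ProbabilityBounded μ s) (k : ℕ) : μ {ω | 2 ^ k < s ω} ≤ (2 ^ k)⁻¹ := by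
  have := hs (2 ^ k) (by positivity)
  push_cast at this
  rwa [one_div, ENNReal.ofReal_inv_of_pos (by positivity), ENNReal.ofReal_pow (by norm_num),
    ENNReal.ofReal_ofNat] at this

theorem exists_isMaximalProbabilityBounded (μ : Measure Cantor) [IsFiniteMeasure μ]
    (hμ : ComputableMeasure μ) : ∃ t, IsMaximalProbabilityBounded μ t := by
  obtain ⟨K, hK⟩ := exists_nat_measure_univ_le μ
  obtain ⟨ok, hok, hokμ⟩ :=
    exists_computable_integral_test μ hμ computable_probabilityStep (K + 1)
  -- The weight ignores the level. The factor `K + 3` is the bound that the test guarantees, and the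
  -- 2 pays for the geometric sum over the levels.
  let D : ℕ → ℕ := fun q => 2 * (K + 3) * 2 ^ (q.unpair.1 + 1)
  have hD0 : ∀ p, 0 < D p := fun p => by positivity
  have hD : Computable D := Computable.nat_mul (Computable.const _)
    (Computable.nat_pow (Computable.const 2)
      (Computable.succ.comp (Computable.fst.comp Computable.unpair)))
  refine ⟨weightedSup probabilityStep ok D,
    ⟨lowerSemicomputable_weightedSup computable_probabilityStep hok hD hD0, ?_⟩, ?_⟩
  · have hle : ∀ q, ∫⁻ ω, acceptedSup probabilityStep ok q ω ∂μ ≤ ((K + 3 : ℕ) : ℝ≥0∞) := by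
      intro q
      refine lintegral_acceptedSup_le (probabilityStep_mono q) fun n hn => ?_
      refine ((hokμ q n).2 hn).trans_eq ?_
      push_cast
      ring
    intro c hc
    have hc' : (0 : ℝ) < c := by exact_mod_cast hc
    rw [one_div, ENNReal.ofReal_inv_of_pos hc']
    set C := ENNReal.ofReal (c : ℝ) with hC
    have hC0 : C ≠ 0 := by simpa [hC] using hc
    have hCt : C ≠ ⊤ := ENNReal.ofReal_ne_top
    have hlevel : ∀ i k, μ {ω | C < acceptedSup probabilityStep ok (Nat.pair i k) ω /
        (D (Nat.pair i k) : ℝ≥0∞)} ≤ ((K + 3 : ℕ) : ℝ≥0∞) *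
          (if C * (D (Nat.pair i 0) : ℝ≥0∞) < 2 ^ k then ((2 : ℝ≥0∞) ^ k)⁻¹ else 0) := by
      intro i k
      have hDik : D (Nat.pair i k) = D (Nat.pair i 0) := by simp [D]
      have hiff : ∀ ω, C < acceptedSup probabilityStep ok (Nat.pair i k) ω /
          (D (Nat.pair i k) : ℝ≥0∞) → C * (D (Nat.pair i 0) : ℝ≥0∞) < 2 ^ k ∧
            2 ^ k ≤ acceptedSup probabilityStep ok (Nat.pair i k) ω := by
        intro ω hω
        rw [ENNReal.lt_div_iff_mul_lt (Or.inr hCt) (by simp), hDik] at hω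
        rcases acceptedSup_probabilityStep_eq_zero_or ok (Nat.pair i k) ω with h | h
        · simp [h] at hω
        · rw [Nat.unpair_pair] at h
          rw [h] at hω ⊢
          exact ⟨hω, le_rfl⟩
      split_ifs with hlt
      · calc _ ≤ μ {ω | 2 ^ k ≤ acceptedSup probabilityStep ok (Nat.pair i k) ω} :=
              measure_mono fun ω hω => (hiff ω hω).2
          _ ≤ (∫⁻ ω, acceptedSup probabilityStep ok (Nat.pair i k) ω ∂μ) / 2 ^ k :=
              meas_ge_le_lintegral_div (measurable_acceptedSup _ _ _).aemeasurable (by simp)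
                (by simp)
          _ ≤ _ := by
              rw [div_eq_mul_inv]
              gcongr
              exact hle _
      · rw [mul_zero, nonpos_iff_eq_zero]
        convert measure_empty (μ := μ)
        exact Set.eq_empty_of_forall_notMem fun ω hω => hlt (hiff ω hω).1
    calc μ {ω | C < weightedSup probabilityStep ok D ω}
        ≤ μ (⋃ i, ⋃ k, {ω | C < acceptedSup probabilityStep ok (Nat.pair i k) ω /
            (D (Nat.pair i k) : ℝ≥0∞)}) := by
          refine measure_mono fun ω hω => ?_
          rw [Set.mem_ofPred_eq, weightedSup, lt_iSup_iff] at hω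
          obtain ⟨q, hq⟩ := hω
          refine Set.mem_iUnion₂.2 ⟨q.unpair.1, q.unpair.2, ?_⟩
          simpa only [Set.mem_ofPred_eq, Nat.pair_unpair] using hq
      _ ≤ ∑' i, ∑' k, ((K + 3 : ℕ) : ℝ≥0∞) *
          (if C * (D (Nat.pair i 0) : ℝ≥0∞) < 2 ^ k then ((2 : ℝ≥0∞) ^ k)⁻¹ else 0) :=
          (measure_iUnion_le _).trans (ENNReal.tsum_le_tsum fun i =>
            (measure_iUnion_le _).trans (ENNReal.tsum_le_tsum fun k => hlevel i k))
      _ ≤ ∑' i : ℕ, C⁻¹ * (2⁻¹ : ℝ≥0∞) ^ (i + 1) := by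
          refine ENNReal.tsum_le_tsum fun i => ?_
          rw [ENNReal.tsum_mul_left]
          calc _ ≤ ((K + 3 : ℕ) : ℝ≥0∞) * (2 * (C * (D (Nat.pair i 0) : ℝ≥0∞))⁻¹) := by
                gcongr
                exact tsum_ite_lt_two_pow_le _
            _ = (((2 * (K + 3) : ℕ) : ℝ≥0∞) * ((2 * (K + 3) : ℕ) : ℝ≥0∞)⁻¹) *
                  (C⁻¹ * (2⁻¹ : ℝ≥0∞) ^ (i + 1)) := by
                simp only [D, Nat.unpair_pair]
                rw [Nat.cast_mul (2 * (K + 3)), ENNReal.mul_inv (Or.inl hC0) (Or.inl hCt),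
                  ENNReal.mul_inv (by simp) (by simp), Nat.cast_pow, ENNReal.inv_pow,
                  Nat.cast_mul 2 (K + 3)]
                push_cast
                ring
            _ = _ := by
                rw [ENNReal.mul_inv_cancel (Nat.cast_ne_zero.2 (by omega)) (ENNReal.natCast_ne_top _),
                  one_mul]
      _ = C⁻¹ := by
          rw [ENNReal.tsum_mul_left, ENNReal.tsum_geometric_add_one, ENNReal.one_sub_inv_two,
            inv_inv, ENNReal.inv_mul_cancel (by simp) (by simp), mul_one]
  · rintro s ⟨hs, hsμ⟩
    obtain ⟨p, hp⟩ := hs.exists_caught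
    -- The step at level `k` is at most `1 + 2 ^ k` times the indicator of `{s > 2 ^ k}`, the 1
    -- being needed for level 0; probability boundedness makes the integral at most `K + 1`.
    have hall : ∀ k n, ok (Nat.pair p k) n = true := by
      intro k n
      refine (hokμ _ n).1 ?_
      have hmeas : MeasurableSet {ω | 2 ^ k < s ω} :=
        measurableSet_lt measurable_const hs.measurable
      calc _ ≤ ∫⁻ ω, 1 + {ω | 2 ^ k < s ω}.indicator (fun _ => 2 ^ k) ω ∂μ := by
            refine lintegral_mono fun ω => ?_
            simp only [probabilityStep, Nat.unpair_pair]
            cases hcaught : caught p k (bitPrefix ω n) with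
            | true =>
              have hmem : ω ∈ {ω | 2 ^ k < s ω} := (hp k ω).2 ⟨n, hcaught⟩
              rw [Set.indicator_of_mem hmem]
              simp
            | false =>
              refine le_add_right ?_
              rcases k with _ | k <;> simp
        _ = μ Set.univ + 2 ^ k * μ {ω | 2 ^ k < s ω} := by
            rw [lintegral_add_left measurable_const, lintegral_indicator_const hmeas]
            simp
        _ ≤ K + 2 ^ k * (2 ^ k)⁻¹ := by
            gcongr
            exact hsμ.measure_two_pow_lt_le k
        _ = _ := by
            rw [ENNReal.mul_inv_cancel (by simp) (by simp)]
            push_cast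
            rfl
    refine ⟨2 * (D (Nat.pair p 0) : ℝ≥0), fun ω => ?_⟩
    have hDk : ∀ k, D (Nat.pair p k) = D (Nat.pair p 0) := fun k => by simp [D]
    have hle : ∀ k n, (probabilityStep (Nat.pair p k) (bitPrefix ω n) : ℝ≥0∞) ≤
        D (Nat.pair p 0) * weightedSup probabilityStep ok D ω := fun k n =>
      calc _ ≤ acceptedSup probabilityStep ok (Nat.pair p k) ω :=
            le_iSup (fun n : {n // ok (Nat.pair p k) n = true} =>
              (probabilityStep (Nat.pair p k) (bitPrefix ω n) : ℝ≥0∞)) ⟨n, hall k n⟩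
        _ = D (Nat.pair p 0) * (acceptedSup probabilityStep ok (Nat.pair p k) ω /
              D (Nat.pair p k)) := by
            rw [hDk k, ENNReal.mul_div_cancel (by exact_mod_cast (hD0 _).ne') (by simp)]
        _ ≤ _ := by
            gcongr
            exact le_iSup (fun q => acceptedSup probabilityStep ok q ω / (D q : ℝ≥0∞)) _
    have hacc : s ω ≤ 2 * (D (Nat.pair p 0) * weightedSup probabilityStep ok D ω) := by
      refine le_two_mul_of_two_pow_le ((hle 0 0).trans' ?_) fun k hk => ?_
      · simp [probabilityStep]
      · obtain ⟨n, hn⟩ := (hp k ω).1 hk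
        refine (hle k n).trans' ?_
        simp [probabilityStep, hn]
    refine hacc.trans_eq ?_
    push_cast
    ring

/-! ### The binary logarithm -/

theorem log2_mono {x y : ℝ≥0∞} (h : x ≤ y) : log2 x ≤ log2 y :=
  EReal.div_le_div_right_of_nonneg (by exact_mod_cast (Real.log_pos one_lt_two).le)
    (ENNReal.log_le_log h)

theorem log2_zero : log2 0 = ⊥ := by
  rw [log2, ENNReal.log_zero]
  exact EReal.bot_div_of_pos_ne_top (by exact_mod_cast Real.log_pos one_lt_two)
    (EReal.coe_ne_top _)

theorem log2_top : log2 ⊤ = ⊤ := by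
  rw [log2, ENNReal.log_top]
  exact EReal.top_div_of_pos_ne_top (by exact_mod_cast Real.log_pos one_lt_two)
    (EReal.coe_ne_top _)

theorem log2_ofReal {r : ℝ} (hr : 0 < r) : log2 (ENNReal.ofReal r) = (Real.logb 2 r : ℝ) := by
  rw [log2, ENNReal.log_ofReal_of_pos hr, Real.logb, EReal.coe_div]

theorem log2_two_pow (k : ℕ) : log2 (2 ^ k) = ((k : ℝ) : EReal) := by
  have : (2 : ℝ≥0∞) ^ k = ENNReal.ofReal (2 ^ k) := by
    rw [ENNReal.ofReal_pow (by norm_num), ENNReal.ofReal_ofNat]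
  rw [this, log2_ofReal (by positivity), Real.logb_pow, Real.logb_self_eq_one one_lt_two, mul_one]

theorem log2_mul_le {C : ℝ} (hC : 0 < C) {x y : ℝ≥0∞} (h : x ≤ ENNReal.ofReal C * y) :
    log2 x ≤ log2 y + (Real.logb 2 C : ℝ) := by
  refine (log2_mono h).trans ?_
  induction y using ENNReal.recTopCoe with
  | top => simp [log2_top]
  | coe y =>
    rcases eq_or_ne y 0 with rfl | hy
    · simp [log2_zero]
    · have hy' : (0 : ℝ) < y := by positivity
      rw [← ENNReal.ofReal_coe_nnreal, ← ENNReal.ofReal_mul hC.le, log2_ofReal hy',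
        log2_ofReal (by positivity), ← EReal.coe_add, Real.logb_mul hC.ne' hy'.ne', add_comm]

theorem truncLog2_coe (d : ℝ) : truncLog2 (d : EReal) = (Real.logb 2 (max d 1) : ℝ) := by
  have : max (d : EReal) 1 = ((max d 1 : ℝ) : EReal) := by
    rw [EReal.coe_strictMono.monotone.map_max, EReal.coe_one]
  rw [truncLog2, this, EReal.toENNReal_of_ne_top (EReal.coe_ne_top _), EReal.toReal_coe,
    log2_ofReal (by positivity)]

theorem truncLog2_top : truncLog2 ⊤ = ⊤ := by
  rw [truncLog2, max_eq_left le_top, EReal.toENNReal_top, log2_top]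

/-- Take the least `j` with `v ≤ 2 ^ j`. For `j ≥ 2` the hypothesis applies with `k = j - 2`; the
cases `j ≤ 1` are covered by `1 ≤ R`. -/
theorem log2_le_coe_of_two_pow_lt {v : ℝ≥0∞} {R : ℝ} (h₁ : 1 ≤ R)
    (h : ∀ k : ℕ, 2 ^ (k + 1) < v → (k : ℝ) + 2 ≤ R) : log2 v ≤ (R : EReal) := by
  have hex : ∃ j : ℕ, v ≤ 2 ^ j := by
    obtain ⟨n, hn⟩ := exists_nat_gt R
    refine ⟨n + 1, not_lt.1 fun hlt => ?_⟩
    linarith [h n hlt]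
  obtain ⟨j, hj, hmin⟩ : ∃ j : ℕ, v ≤ 2 ^ j ∧ ∀ i < j, ¬ v ≤ 2 ^ i := by
    classical exact ⟨Nat.find hex, Nat.find_spec hex, fun i hi => Nat.find_min hex hi⟩
  refine (log2_mono hj).trans ?_
  rw [log2_two_pow, EReal.coe_le_coe_iff]
  rcases j with _ | _ | j
  · simpa using zero_le_one.trans h₁
  · simpa using h₁
  · have := h j (not_le.1 (hmin (j + 1) (by omega)))
    push_cast
    linarith

/-- A crude bound bootstraps itself: `log₂ x ≤ x / 4 + 3` and `η ≤ 1` turn the hypothesis into `x /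
2 - 6 ≤ d + B`, so `x` is at most a constant times `max d 1`. Substituting this into the logarithm
gives the sharp estimate. -/
theorem exists_logb_bound {η : ℝ} (hη : 0 < η) (hη1 : η ≤ 1) (B : ℝ) :
    ∃ c : ℝ, ∀ x d : ℝ, 1 ≤ x → x - (1 + η) * Real.logb 2 x ≤ d + B →
      x + 1 ≤ d + (1 + η) * Real.logb 2 (max d 1) + c := by
  refine ⟨|B| + 1 + (1 + η) * Real.logb 2 (2 * |B| + 14), fun x d hx h => ?_⟩
  have hx0 : 0 < x := by linarith
  have hlog2 : 1 / 2 < Real.log 2 := by linarith [Real.log_two_gt_d9]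
  have hB := le_abs_self B
  have hB0 := abs_nonneg B
  have hL : Real.logb 2 x ≤ x / 4 + 3 := by
    have h₁ : Real.log (x / 8) ≤ x / 8 - 1 := Real.log_le_sub_one_of_pos (by positivity)
    have h₂ : Real.log 8 = 3 * Real.log 2 := by
      rw [show (8 : ℝ) = 2 ^ 3 by norm_num, Real.log_pow]
      norm_num
    rw [Real.log_div hx0.ne' (by norm_num), h₂] at h₁
    rw [Real.logb, div_le_iff₀ (by linarith)]
    nlinarith
  have hL0 : 0 ≤ Real.logb 2 x := Real.logb_nonneg one_lt_two hx
  have hm1 : 1 ≤ max d 1 := le_max_right _ _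
  have hmd : d ≤ max d 1 := le_max_left _ _
  have hxm : x ≤ (2 * |B| + 14) * max d 1 := by nlinarith
  have hlog : Real.logb 2 x ≤ Real.logb 2 (2 * |B| + 14) + Real.logb 2 (max d 1) := by
    rw [← Real.logb_mul (by positivity) (by positivity)]
    exact Real.logb_le_logb_of_le one_lt_two hx0 hxm
  nlinarith [mul_le_mul_of_nonneg_left hlog (show 0 ≤ 1 + η by linarith)]

/-! ### Comparison of the maximal functions -/

theorem ExpectationBounded.probabilityBounded {μ : Measure Cantor} {t : Cantor → ℝ≥0∞}
    (ht : Measurable t) (h : ExpectationBounded μ t) : ProbabilityBounded μ t := by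
  intro c hc
  have hc' : (0 : ℝ) < c := by exact_mod_cast hc
  calc μ {ω | ENNReal.ofReal (c : ℝ) < t ω}
      ≤ μ {ω | ENNReal.ofReal (c : ℝ) ≤ t ω} := measure_mono fun ω hω => by
          rw [Set.mem_ofPred_eq] at hω ⊢
          exact hω.le
    _ ≤ (∫⁻ ω, t ω ∂μ) / ENNReal.ofReal (c : ℝ) :=
      meas_ge_le_lintegral_div ht.aemeasurable (by simpa using hc) ENNReal.ofReal_ne_top
    _ ≤ 1 / ENNReal.ofReal (c : ℝ) := ENNReal.div_le_div_right h _
    _ = ENNReal.ofReal (1 / (c : ℝ)) := by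
      rw [ENNReal.ofReal_div_of_pos hc', ENNReal.ofReal_one]

theorem lowerSemicomputable_const {K : ℕ} (hK : 0 < K) :
    LowerSemicomputable fun _ => ((1 : ℕ) : ℝ≥0∞) / (K : ℝ≥0∞) := by
  have hr : Computable fun q : (ℕ × ℕ) × List Bool => q.1 := Computable.fst
  refine ⟨_, REPred.of_computable (Computable.decide_lt
    (Computable.nat_mul (Computable.const K) (Computable.fst.comp hr))
    (Computable.nat_mul (Computable.const 1)
      (Computable.succ.comp (Computable.snd.comp hr)))), fun r => ?_⟩
  ext ω
  simp only [Set.mem_ofPred_eq, ofReal_ratOfCode_lt_div_iff r 1 hK, Set.mem_iUnion, exists_prop,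
    decide_eq_true_iff]
  exact ⟨fun h => ⟨_, h, mem_interval_bitPrefix ω 0⟩, fun ⟨_, h, _⟩ => h⟩

/-- The constant `1 / (K + 1)`, with `μ Set.univ ≤ K`, is in the class, so `t` dominates a multiple
of it. This bounds the deficiency below by a real number. -/
theorem IsMaximalExpectationBounded.exists_pos_le {μ : Measure Cantor} [IsFiniteMeasure μ]
    {t : Cantor → ℝ≥0∞} (ht : IsMaximalExpectationBounded μ t) :
    ∃ δ : ℝ, 0 < δ ∧ ∀ ω, ENNReal.ofReal δ ≤ t ω := by
  obtain ⟨K, hK⟩ := exists_nat_measure_univ_le μ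
  obtain ⟨C, hC⟩ := ht.2 _ ⟨lowerSemicomputable_const K.succ_pos, by
    rw [ExpectationBounded, lintegral_const, Nat.cast_one, one_div]
    rw [ENNReal.inv_mul_le_iff (by simp) (by simp), mul_one]
    exact hK.trans (by exact_mod_cast K.le_succ)⟩
  refine ⟨1 / ((K + 1) * (C + 1)), by positivity, fun ω => ?_⟩
  have h₁ : ((1 : ℕ) : ℝ≥0∞) / ((K + 1 : ℕ) : ℝ≥0∞) ≤ ((C + 1 : ℝ≥0) : ℝ≥0∞) * t ω := by
    refine (hC ω).trans ?_
    gcongr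
    exact le_add_right le_rfl
  have h₂ : ((1 : ℕ) : ℝ≥0∞) / ((K + 1 : ℕ) : ℝ≥0∞) = ENNReal.ofReal (1 / (K + 1)) := by
    rw [ENNReal.ofReal_div_of_pos (by positivity), ENNReal.ofReal_one, Nat.cast_one,
      ← Nat.cast_add_one, ENNReal.ofReal_natCast]
  have h₃ : ((C + 1 : ℝ≥0) : ℝ≥0∞) = ENNReal.ofReal (C + 1) := by
    rw [← ENNReal.ofReal_coe_nnreal]
    simp
  rw [h₂, h₃] at h₁
  rw [← div_div, ENNReal.ofReal_div_of_pos (by positivity)]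
  refine ENNReal.div_le_of_le_mul ?_
  rwa [mul_comm]

theorem exists_deficiency_le_add {μ : Measure Cantor} {tE tP : Cantor → ℝ≥0∞}
    (hE : IsMaximalExpectationBounded μ tE) (hP : IsMaximalProbabilityBounded μ tP) :
    ∃ c : ℝ, ∀ ω, deficiency tE ω ≤ deficiency tP ω + (c : EReal) := by
  obtain ⟨C, hC⟩ := hP.2 tE ⟨hE.1.1, hE.1.2.probabilityBounded hE.1.1.measurable⟩
  refine ⟨Real.logb 2 (C + 1), fun ω => log2_mul_le (by positivity) ((hC ω).trans ?_)⟩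
  gcongr
  rw [← ENNReal.ofReal_coe_nnreal]
  exact ENNReal.ofReal_le_ofReal (by simp)

/-- The exponent `1 + 1 / m` is rational, so taking `m`-th powers leaves a decidable inequality
between natural numbers. -/
theorem ofReal_ratOfCode_lt_rpow_iff {m : ℕ} (hm : 0 < m) {N : ℕ} (hN : 0 < N) (r : ℕ × ℕ) (k : ℕ) :
    ENNReal.ofReal (ratOfCode r : ℝ) <
        ENNReal.ofReal (2 ^ (k + 1) * ((k + 1 : ℕ) : ℝ) ^ (-(1 + 1 / m : ℝ)) / N) ↔
      (r.1 * N) ^ m * (k + 1) ^ (m + 1) < (2 ^ (k + 1) * (r.2 + 1)) ^ m := by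
  have h0 : (0 : ℝ) ≤ (ratOfCode r : ℝ) := by
    unfold ratOfCode
    positivity
  have hk : (0 : ℝ) < ((k + 1 : ℕ) : ℝ) := by positivity
  have hN' : (0 : ℝ) < N := by exact_mod_cast hN
  have hm' : (m : ℝ) ≠ 0 := by positivity
  set y : ℝ := ((k + 1 : ℕ) : ℝ) ^ (1 + 1 / m : ℝ) with hy
  have hy0 : 0 < y := Real.rpow_pos_of_pos hk _
  have hym : y ^ m = ((k + 1 : ℕ) : ℝ) ^ (m + 1) := by
    rw [hy, ← Real.rpow_natCast, ← Real.rpow_mul hk.le, ← Real.rpow_natCast]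
    congr 1
    push_cast
    field_simp
  rw [ENNReal.ofReal_lt_ofReal_iff_of_nonneg h0, Real.rpow_neg hk.le, ← hy]
  have e : (2 : ℝ) ^ (k + 1) * y⁻¹ / N = 2 ^ (k + 1) / (N * y) := by
    field_simp
  rw [e]
  unfold ratOfCode
  push_cast
  rw [div_lt_div_iff₀ (by positivity) (by positivity), ← mul_assoc,
    ← pow_lt_pow_iff_left₀ (by positivity) (by positivity) hm.ne', mul_pow (_ * _) y, hym]
  exact_mod_cast Iff.rfl

theorem LowerSemicomputable.exists_expectationBounded {μ : Measure Cantor} {t : Cantor → ℝ≥0∞}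
    (ht : LowerSemicomputable t) (hμ : ProbabilityBounded μ t) {m : ℕ} (hm : 0 < m) :
    ∃ N : ℕ, 0 < N ∧ ∃ s, (LowerSemicomputable s ∧ ExpectationBounded μ s) ∧
      ∀ k ω, 2 ^ (k + 1) < t ω →
        ENNReal.ofReal (2 ^ (k + 1) * ((k + 1 : ℕ) : ℝ) ^ (-(1 + 1 / m : ℝ)) / N) ≤ s ω := by
  set b : ℕ → ℝ := fun k => ((k + 1 : ℕ) : ℝ) ^ (-(1 + 1 / m : ℝ)) with hb
  have hb0 : ∀ k, 0 ≤ b k := fun k => by positivity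
  have hsum : Summable b := by
    have : Summable fun n : ℕ => (n : ℝ) ^ (-(1 + 1 / m : ℝ)) := by
      rw [Real.summable_nat_rpow]
      have : (0 : ℝ) < 1 / m := by positivity
      linarith
    exact (summable_nat_add_iff 1).2 this
  obtain ⟨N, hN⟩ := exists_nat_gt (∑' k, b k)
  have hN0 : (0 : ℝ) < N := (tsum_nonneg hb0).trans_lt hN
  have hN0' : 0 < N := by exact_mod_cast hN0
  set a : ℕ → ℝ≥0∞ := fun k => ENNReal.ofReal (2 ^ (k + 1) * b k / N) with ha
  refine ⟨N, hN0', fun ω => ⨆ k : ℕ, ⨆ _ : 2 ^ (k + 1) < t ω, a k, ⟨?_, ?_⟩, fun k ω hk =>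
    le_iSup₂_of_le k hk le_rfl⟩
  · obtain ⟨W, hW, hWt⟩ := ht
    have hx : Computable fun q : ((ℕ × ℕ) × List Bool) × ℕ => q.1.2 :=
      Computable.snd.comp Computable.fst
    have hr : Computable fun q : ((ℕ × ℕ) × List Bool) × ℕ => q.1.1 :=
      Computable.fst.comp Computable.fst
    have hk : Computable fun q : ((ℕ × ℕ) × List Bool) × ℕ => q.2 + 1 :=
      Computable.succ.comp Computable.snd
    have h2k : Computable fun q : ((ℕ × ℕ) × List Bool) × ℕ => 2 ^ (q.2 + 1) :=
      Computable.nat_pow (Computable.const 2) hk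
    have hlevel : REPred fun q : ((ℕ × ℕ) × List Bool) × ℕ => W ((2 ^ (q.2 + 1), 0), q.1.2) :=
      hW.comp_computable ((h2k.pair (Computable.const 0)).pair hx)
    have hvalue : Computable fun q : ((ℕ × ℕ) × List Bool) × ℕ =>
        decide ((q.1.1.1 * N) ^ m * (q.2 + 1) ^ (m + 1) <
          (2 ^ (q.2 + 1) * (q.1.1.2 + 1)) ^ m) :=
      Computable.decide_lt
        (Computable.nat_mul
          (Computable.nat_pow (Computable.nat_mul (Computable.fst.comp hr) (Computable.const N))
            (Computable.const m))
          (Computable.nat_pow hk (Computable.const (m + 1))))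
        (Computable.nat_pow
          (Computable.nat_mul h2k (Computable.succ.comp (Computable.snd.comp hr)))
          (Computable.const m))
    refine ⟨_, (hlevel.and_computable hvalue).exists_nat, fun r => ?_⟩
    ext ω
    simp only [Set.mem_ofPred_eq, lt_iSup_iff, Set.mem_iUnion, exists_prop, decide_eq_true_iff,
      ← ofReal_ratOfCode_lt_rpow_iff hm hN0', ha, hb]
    have h₁ : ∀ k, 2 ^ (k + 1) < t ω ↔ ∃ x, W ((2 ^ (k + 1), 0), x) ∧ ω ∈ interval x := by
      intro k
      have := Set.ext_iff.1 (hWt (2 ^ (k + 1), 0)) ω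
      simpa only [ofReal_ratOfCode_two_pow, Set.mem_ofPred_eq, Set.mem_iUnion, exists_prop]
        using this
    simp only [h₁]
    constructor
    · rintro ⟨k, ⟨x, hWx, hωx⟩, h⟩
      exact ⟨x, ⟨k, hWx, h⟩, hωx⟩
    · rintro ⟨x, ⟨k, hWx, h⟩, hωx⟩
      exact ⟨k, ⟨x, hWx, hωx⟩, h⟩
  · have hmeas : ∀ k : ℕ, MeasurableSet {ω | 2 ^ (k + 1) < t ω} := fun k =>
      measurableSet_lt measurable_const ht.measurable
    calc ∫⁻ ω, ⨆ k : ℕ, ⨆ _ : 2 ^ (k + 1) < t ω, a k ∂μ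
        ≤ ∫⁻ ω, ∑' k : ℕ, {ω | 2 ^ (k + 1) < t ω}.indicator (fun _ => a k) ω ∂μ := by
          refine lintegral_mono fun ω => iSup₂_le fun k hk => ?_
          refine le_trans ?_ (ENNReal.le_tsum k)
          rw [Set.indicator_of_mem (show ω ∈ {ω | 2 ^ (k + 1) < t ω} from hk)]
      _ = ∑' k : ℕ, a k * μ {ω | 2 ^ (k + 1) < t ω} := by
          rw [lintegral_tsum fun k => (measurable_const.indicator (hmeas k)).aemeasurable]
          simp_rw [lintegral_indicator_const (hmeas _)]
      _ ≤ ∑' k : ℕ, ENNReal.ofReal (b k / N) := by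
          refine ENNReal.tsum_le_tsum fun k => ?_
          calc _ ≤ a k * (2 ^ (k + 1))⁻¹ := by
                gcongr
                exact hμ.measure_two_pow_lt_le (k + 1)
            _ = ENNReal.ofReal (b k / N) * (2 ^ (k + 1) * (2 ^ (k + 1))⁻¹) := by
                rw [ha]
                simp only
                rw [mul_div_assoc, ENNReal.ofReal_mul (by positivity),
                  ENNReal.ofReal_pow (by norm_num), ENNReal.ofReal_ofNat]
                ring
            _ = _ := by rw [ENNReal.mul_inv_cancel (by simp) (by simp), mul_one]
      _ = ENNReal.ofReal (∑' k, b k / N) :=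
          (ENNReal.ofReal_tsum_of_nonneg (fun k => div_nonneg (hb0 k) hN0.le)
            (hsum.div_const _)).symm
      _ ≤ 1 := by
          rw [tsum_div_const, ENNReal.ofReal_le_one, div_le_one hN0]
          exact hN.le

theorem exists_deficiency_le_add_log {μ : Measure Cantor} [IsFiniteMeasure μ]
    {tE tP : Cantor → ℝ≥0∞} (hE : IsMaximalExpectationBounded μ tE)
    (hP : IsMaximalProbabilityBounded μ tP) {ε : ℝ} (hε : 0 < ε) :
    ∃ c : ℝ, ∀ ω, deficiency tP ω ≤
      deficiency tE ω + ((1 + ε : ℝ) : EReal) * truncLog2 (deficiency tE ω) + (c : EReal) := by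
  obtain ⟨m, hm⟩ := exists_nat_one_div_lt hε
  obtain ⟨N, hN0, s, hs, hsP⟩ :=
    hP.1.1.exists_expectationBounded hP.1.2 (m := m + 1) m.succ_pos
  obtain ⟨C, hC⟩ := hE.2 s hs
  obtain ⟨δ, hδ0, hδ⟩ := hE.exists_pos_le
  set η : ℝ := 1 / ((m + 1 : ℕ) : ℝ) with hη
  have hη0 : 0 < η := by positivity
  have hη1 : η ≤ 1 := by
    rw [hη, div_le_one (by positivity)]
    exact_mod_cast Nat.le_add_left 1 m
  have hηε : η ≤ ε := by
    rw [hη]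
    push_cast
    exact hm.le
  obtain ⟨c, hc⟩ := exists_logb_bound hη0 hη1 (Real.logb 2 (N * (C + 1)))
  -- The second entry makes the right-hand side at least 1, as `log2_le_coe_of_two_pow_lt` requires,
  -- because `d ≥ log₂ δ`.
  refine ⟨max c (1 - Real.logb 2 δ), fun ω => ?_⟩
  rcases eq_or_ne (tE ω) ⊤ with htop | htop
  · have hpos : (0 : ℝ) < 1 + ε := by linarith
    simp only [deficiency, htop, log2_top, truncLog2_top, EReal.coe_mul_top_of_pos hpos]
    simp
  · have hle := hδ ω
    have hsC := hC ω
    rw [deficiency, deficiency]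
    obtain ⟨e, he⟩ : ∃ e : ℝ, e = (tE ω).toReal := ⟨_, rfl⟩
    have hte : tE ω = ENNReal.ofReal e := by rw [he, ENNReal.ofReal_toReal htop]
    have he0' : 0 ≤ e := he ▸ ENNReal.toReal_nonneg
    rw [hte] at hle hsC ⊢
    rw [ENNReal.ofReal_le_ofReal_iff he0'] at hle
    have he0 : 0 < e := hδ0.trans_le hle
    have hd : Real.logb 2 δ ≤ Real.logb 2 e := Real.logb_le_logb_of_le one_lt_two hδ0 hle
    rw [log2_ofReal he0, truncLog2_coe, ← EReal.coe_mul, ← EReal.coe_add, ← EReal.coe_add]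
    set d := Real.logb 2 e
    have hL0 : 0 ≤ Real.logb 2 (max d 1) := Real.logb_nonneg one_lt_two (le_max_right _ _)
    have hcm := le_max_left c (1 - Real.logb 2 δ)
    have hδm := le_max_right c (1 - Real.logb 2 δ)
    refine log2_le_coe_of_two_pow_lt ?_ fun k hk => ?_
    · nlinarith [mul_nonneg (show 0 ≤ 1 + ε by linarith) hL0]
    · have hk0 : (0 : ℝ) < ((k + 1 : ℕ) : ℝ) := by positivity
      have hN0' : (0 : ℝ) < N := by exact_mod_cast hN0
      have h₁ := (hsP k ω hk).trans hsC
      rw [← ENNReal.ofReal_coe_nnreal, ← ENNReal.ofReal_mul C.coe_nonneg,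
        ENNReal.ofReal_le_ofReal_iff (by positivity), div_le_iff₀ hN0'] at h₁
      -- Enlarging `C` to `C + 1` keeps the factor positive, so that logarithms can be taken; the
      -- result is the hypothesis of `exists_logb_bound` for `x = k + 1`.
      have h₂ : 2 ^ (k + 1) * ((k + 1 : ℕ) : ℝ) ^ (-(1 + η)) ≤ e * (N * (C + 1)) := by
        nlinarith [mul_pos he0 hN0']
      have h₃ := Real.logb_le_logb_of_le one_lt_two (by positivity) h₂
      rw [Real.logb_mul (by positivity) (by positivity), Real.logb_mul he0.ne' (by positivity),
        Real.logb_pow, Real.logb_self_eq_one one_lt_two, mul_one,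
        Real.logb_rpow_eq_mul_logb_of_pos hk0] at h₃
      have h₄ := hc ((k + 1 : ℕ) : ℝ) d (by exact_mod_cast Nat.le_add_left 1 k) (by linarith)
      push_cast at h₄
      nlinarith [mul_le_mul_of_nonneg_right hηε hL0]

theorem mainTheorem3 (μ : Measure Cantor) [IsFiniteMeasure μ] (hμ : ComputableMeasure μ) :
    (∃ tE : Cantor → ℝ≥0∞, IsMaximalExpectationBounded μ tE) ∧
    (∃ tP : Cantor → ℝ≥0∞, IsMaximalProbabilityBounded μ tP) ∧
    ∀ tE tP : Cantor → ℝ≥0∞,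
      IsMaximalExpectationBounded μ tE → IsMaximalProbabilityBounded μ tP →
      (∃ c : ℝ, ∀ ω : Cantor, deficiency tE ω ≤ deficiency tP ω + (c : EReal)) ∧
      ∀ ε : ℝ, 0 < ε → ∃ c : ℝ, ∀ ω : Cantor,
        deficiency tP ω ≤
          deficiency tE ω + ((1 + ε : ℝ) : EReal) * truncLog2 (deficiency tE ω) + (c : EReal) := by
  refine ⟨exists_isMaximalExpectationBounded μ hμ, exists_isMaximalProbabilityBounded μ hμ,
    fun tE tP hE hP => ⟨exists_deficiency_le_add hE hP, fun ε hε => ?_⟩⟩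
  exact exists_deficiency_le_add_log hE hP hε
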